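/- **Notation.** All logarithms are natural. For random variables $U,V,W$ let $I(U;V\mid W)=D_{\mathrm{KL}}\big(P_{WUV}\,\|\,P_W\otimes(P_{U|W}\times P_{V|W})\big)$ be the conditional mutual information. A randomized mechanism $M$ acting on databases $x=(x_1,\dots,x_n)\in(\mathbb R^d)^n$ is *$\varepsilon$-MI DP over a class $\Theta$ of laws on $(\mathbb R^d)^n$* if $$\sup_{P\in\Theta,\ 1\le i\le n} I\big(X_i;M(X)\,\big|\,(X_j)_{j\ne i}\big)\le\varepsilon ,\qquad X=(X_1,\dots,X_n)\sim P .$$ **Algorithm.** Input: $x\in(\mathbb R^d)^n$, $\varepsilon>0$, $\beta\in(0,1)$ and a second moment bound $c>0$. Put $$m=\lceil 200\log(1/\beta)\rceil,\qquad k=\lfloor n/m\rfloor,\qquad \sigma^2=\frac{d\,c}{2k^2\varepsilon},$$ $$\tilde\mu_p=\frac1k\sum_{i=(p-1)k+1}^{pk}x_i+Z_p\quad(p=1,\dots,m),\qquad Z_1,\dots,Z_m\ \text{i.i.d.}\ \mathcal N(0,\sigma^2 I_d),$$ and output a geometric median $\hat\mu_n\in\arg\min_{y\in\mathbb R^d}\sum_{p=1}^m\|y-\tilde\mu_p\|$,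 where $\|\cdot\|$ is the Euclidean norm and ties are broken by an arbitrary fixed measurable rule. The algorithm is run with $n\ge m$, so that $k\ge1$. **Proposition (mean estimation under $\varepsilon$-MI DP).** For every $c>0$ there is a constant $C>0$, depending only on $c$, such that for all $d\ge1$, $\alpha,\varepsilon>0$, $\beta\in(0,1)$, all $n\ge m$ and every measurable tie-breaking rule the following holds. 1. (Privacy) The map $x\mapsto\hat\mu_n$ is $\varepsilon$-MI DP over the class of all laws on $(\mathbb R^d)^n$ whose rows have finite second moments with $\mathbb E\|X_i-\mathbb E X_i\|^2\le c$ for all $i$; in particular this holds for i.i.d. samples of any distribution with second central moment at most $c$. 2. (Accuracy) If $$n\ \ge\ C\,\max\{1,\log(1/\beta)\}\left(\frac{d}{\alpha^2}+\frac{d}{\alpha\sqrt{\varepsilon}}\right),$$ and the algorithm is fed with $n$ i.i.d. samples of a distribution on $\mathbb R^d$ with mean $\mu$ and finite second moment with $\mathbb E\|X-\mu\|^2\le c$, then $$\mathbb P\big(\|\hat\mu_n-\mu\|\le\alpha\big)\ge1-\beta .$$ -/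

import Mathlib

open MeasureTheory ProbabilityTheory Filter Topology

open scoped ENNReal

noncomputable section

namespace MIPrivacy

/-! ### Conditional mutual information and mutual information differential privacy -/

section Privacy

variable {Ω 𝓤 𝓥 𝓦 : Type*} [MeasurableSpace Ω]
  [MeasurableSpace 𝓤] [StandardBorelSpace 𝓤] [Nonempty 𝓤]
  [MeasurableSpace 𝓥] [StandardBorelSpace 𝓥] [Nonempty 𝓥] [MeasurableSpace 𝓦]

/-- The conditional mutual information `I(U; V | W)` (in nats) of random variables on `(Ω, P)`:
the Kullback–Leibler divergence of the joint law `P_{W,U,V}` from `P_W ⊗ (P_{U|W} × P_{V|W})`. -/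
def condMutualInfo (P : Measure Ω) [IsFiniteMeasure P] (U : Ω → 𝓤) (V : Ω → 𝓥) (W : Ω → 𝓦) :
    ℝ≥0∞ :=
  InformationTheory.klDiv (P.map fun ω => (W ω, U ω, V ω))
    ((P.map W) ⊗ₘ (condDistrib U W P ×ₖ condDistrib V W P))

variable {𝓧 𝓨 : Type*} [MeasurableSpace 𝓧] [StandardBorelSpace 𝓧] [Nonempty 𝓧]
  [MeasurableSpace 𝓨] [StandardBorelSpace 𝓨] [Nonempty 𝓨]

/-- A randomized mechanism `M` (the kernel `x ↦ law of M(x)`) acting on databases with `n` rows is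
`ε`-mutual information differentially private over the class `Θ` of database laws if
`sup_{P ∈ Θ, i} I(X_i; M(X) | (X_j)_{j ≠ i}) ≤ ε`, where `X ∼ P`. -/
def IsMIDP {n : ℕ} (M : Kernel (Fin n → 𝓧) 𝓨) [IsMarkovKernel M] (ε : ℝ)
    (Θ : Set (ProbabilityMeasure (Fin n → 𝓧))) : Prop :=
  ⨆ P ∈ Θ, ⨆ i : Fin n,
    condMutualInfo ((P : Measure (Fin n → 𝓧)) ⊗ₘ M)
      (fun q => q.1 i) (fun q => q.2) (fun q => fun j : {j : Fin n // j ≠ i} => q.1 j)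
    ≤ ENNReal.ofReal ε

end Privacy

/-- Laws on databases with `n` rows in `ℝ^d` (the rows may be dependent) such that every row has a
finite second moment and satisfies `E‖X_i - E X_i‖² ≤ c`. -/
def secondMomentClass (n d : ℕ) (c : ℝ) :
    Set (ProbabilityMeasure (Fin n → EuclideanSpace ℝ (Fin d))) :=
  {P | ∀ i, MemLp (fun x => x i) 2 (P : Measure (Fin n → EuclideanSpace ℝ (Fin d))) ∧
    ∫ x, ‖x i - ∫ x', x' i ∂(P : Measure (Fin n → EuclideanSpace ℝ (Fin d)))‖ ^ 2
      ∂(P : Measure (Fin n → EuclideanSpace ℝ (Fin d))) ≤ c}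

/-! ### Geometric medians -/

/-- `y` is a geometric median of `v_1, …, v_m`, that is, `y ∈ argmin_z ∑ p, ‖z - v_p‖`. -/
def IsGeometricMedian {m d : ℕ} (v : Fin m → EuclideanSpace ℝ (Fin d))
    (y : EuclideanSpace ℝ (Fin d)) : Prop :=
  ∀ z, ∑ p, ‖y - v p‖ ≤ ∑ p, ‖z - v p‖

/-- A measurable choice of a geometric median of `m` points (minimizers need not be unique). -/
structure MedianSelector (m d : ℕ) where
  toFun : (Fin m → EuclideanSpace ℝ (Fin d)) → EuclideanSpace ℝ (Fin d)
  measurable : Measurable toFun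
  isGeometricMedian : ∀ v, IsGeometricMedian v (toFun v)

/-- Jointly regular families of convex functions that attain their minima have a measurable choice
of minimizers; this makes the choice of a geometric median below legitimate. -/
theorem exists_measurable_minimizer {X E : Type*} [PseudoMetricSpace X] [MeasurableSpace X]
    [BorelSpace X] [NormedAddCommGroup E] [InnerProductSpace ℝ E] [FiniteDimensional ℝ E]
    [MeasurableSpace E] [BorelSpace E] (F : X → E → ℝ)
    (hconv : ∀ x y z, F x ((1 / 2 : ℝ) • (y + z)) ≤ (F x y + F x z) / 2)
    (hcont : ∀ x, Continuous (F x)) (hnn : ∀ x y, 0 ≤ F x y)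
    (hex : ∀ x, ∃ y, ∀ z, F x y ≤ F x z)
    (K : ℝ) (hlip : ∀ x x' y, |F x y - F x' y| ≤ K * dist x x') :
    ∃ g : X → E, Measurable g ∧ ∀ x z, F x (g x) ≤ F x z := by
  have key : ∀ (x : X) (t : ℝ), 0 < t → ∃ y, ∀ z, F x y + t * ‖y‖ ^ 2 ≤ F x z + t * ‖z‖ ^ 2 := by
    intro x t ht
    refine Continuous.exists_forall_le (by have := hcont x; fun_prop) ?_
    refine tendsto_atTop_mono (f := fun z => t * ‖z‖ ^ 2) (fun z => by linarith [hnn x z]) ?_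
    exact (((tendsto_pow_atTop two_ne_zero).comp tendsto_norm_cocompact_atTop)).const_mul_atTop ht
  choose! y hy using key
  have strong : ∀ x t, 0 < t → ∀ z,
      F x (y x t) + t * ‖y x t‖ ^ 2 + t / 2 * ‖y x t - z‖ ^ 2 ≤ F x z + t * ‖z‖ ^ 2 := by
    intro x t ht z
    have h1 := hy x t ht ((1 / 2 : ℝ) • (y x t + z))
    have h2 := hconv x (y x t) z
    have h3 := parallelogram_law_with_norm ℝ (y x t) z
    have h4 : ‖(1 / 2 : ℝ) • (y x t + z)‖ ^ 2 = ‖y x t + z‖ ^ 2 / 4 := by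
      rw [norm_smul, mul_pow]; norm_num; ring
    rw [h4] at h1
    nlinarith
  have hmeas : ∀ t, 0 < t → Measurable fun x => y x t := by
    intro t ht
    refine Continuous.measurable (continuous_iff_continuousAt.2 fun x => ?_)
    rw [ContinuousAt, tendsto_iff_norm_sub_tendsto_zero]
    have hb : ∀ x', ‖y x' t - y x t‖ ^ 2 ≤ 4 * K / t * dist x x' := by
      intro x'
      have h1 := strong x t ht (y x' t)
      have h2 := hy x' t ht (y x t)
      have h3 := abs_le.1 (hlip x x' (y x t))
      have h4 := abs_le.1 (hlip x x' (y x' t))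
      rw [norm_sub_rev] at h1
      have : t / 2 * ‖y x' t - y x t‖ ^ 2 ≤ 2 * (K * dist x x') := by linarith
      calc ‖y x' t - y x t‖ ^ 2 = 2 / t * (t / 2 * ‖y x' t - y x t‖ ^ 2) := by field_simp
        _ ≤ 2 / t * (2 * (K * dist x x')) := by gcongr
        _ = _ := by ring
    have hd : Tendsto (fun x' => √(4 * K / t * dist x x')) (𝓝 x) (𝓝 0) := by
      have : Continuous fun x' => √(4 * K / t * dist x x') := by fun_prop
      simpa using this.tendsto x
    refine squeeze_zero (fun _ => norm_nonneg _) (fun x' => ?_) hd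
    exact Real.le_sqrt_of_sq_le (hb x')
  have hlim : ∀ x, ∃ l, Tendsto (fun k : ℕ => y x (1 / ((k : ℝ) + 1))) atTop (𝓝 l) := by
    intro x
    have hpos : ∀ k : ℕ, (0 : ℝ) < 1 / ((k : ℝ) + 1) := fun k => by positivity
    have hstep : ∀ j k : ℕ, k ≤ j →
        ‖y x (1 / ((k : ℝ) + 1)) - y x (1 / ((j : ℝ) + 1))‖ ^ 2 / 2 ≤
          ‖y x (1 / ((j : ℝ) + 1))‖ ^ 2 - ‖y x (1 / ((k : ℝ) + 1))‖ ^ 2 := by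
      intro j k hkj
      have hle : 1 / ((j : ℝ) + 1) ≤ 1 / ((k : ℝ) + 1) := by gcongr
      have h1 := strong x _ (hpos k) (y x (1 / ((j : ℝ) + 1)))
      have h2 := strong x _ (hpos j) (y x (1 / ((k : ℝ) + 1)))
      rw [norm_sub_rev] at h2
      have hs := hpos j
      have ht := hpos k
      generalize 1 / ((j : ℝ) + 1) = s at *
      generalize 1 / ((k : ℝ) + 1) = t at *
      have hA : (t + s) * (‖y x t - y x s‖ ^ 2 / 2) ≤
          (t - s) * (‖y x s‖ ^ 2 - ‖y x t‖ ^ 2) := by nlinarith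
      have hN : 0 ≤ ‖y x t - y x s‖ ^ 2 := by positivity
      rcases hle.eq_or_lt with he | hlt
      · subst he; simp
      · by_contra! hc
        have h5 : (t - s) * (‖y x s‖ ^ 2 - ‖y x t‖ ^ 2) < (t - s) * (‖y x t - y x s‖ ^ 2 / 2) :=
          mul_lt_mul_of_pos_left hc (by linarith)
        nlinarith
    obtain ⟨z, hz⟩ := hex x
    set a : ℕ → ℝ := fun k => ‖y x (1 / ((k : ℝ) + 1))‖ ^ 2 with ha
    have hmono : Monotone a := by
      intro k j hkj
      have := hstep j k hkj
      have h0 : 0 ≤ ‖y x (1 / ((k : ℝ) + 1)) - y x (1 / ((j : ℝ) + 1))‖ ^ 2 / 2 := by positivity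
      simp only [ha]; linarith
    have hbdd : BddAbove (Set.range a) := by
      refine ⟨‖z‖ ^ 2, ?_⟩
      rintro _ ⟨k, rfl⟩
      have h1 := hy x _ (hpos k) z
      have h2 := hz (y x (1 / ((k : ℝ) + 1)))
      exact le_of_mul_le_mul_left (by simp only [ha]; linarith) (hpos k)
    have hcau : CauchySeq a := (tendsto_atTop_ciSup hmono hbdd).cauchySeq
    refine cauchySeq_tendsto_of_complete (Metric.cauchySeq_iff'.2 fun e he => ?_)
    obtain ⟨N, hN⟩ := Metric.cauchySeq_iff'.1 hcau (e ^ 2 / 2) (by positivity)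
    refine ⟨N, fun k hk => ?_⟩
    have h1 := hstep k N hk
    have h2 := hN k hk
    rw [Real.dist_eq] at h2
    have h3 := (abs_lt.1 h2).2
    rw [dist_comm, dist_eq_norm]
    simp only [ha] at h3
    exact lt_of_pow_lt_pow_left₀ 2 he.le (by linarith)
  choose g hg using hlim
  refine ⟨g, measurable_of_tendsto_metrizable (fun k => hmeas _ (by positivity))
    (tendsto_pi_nhds.2 hg), fun x z => ?_⟩
  have h1 : Tendsto (fun k : ℕ => F x (y x (1 / ((k : ℝ) + 1)))) atTop (𝓝 (F x (g x))) :=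
    ((hcont x).tendsto _).comp (hg x)
  have h2 : Tendsto (fun k : ℕ => F x z + 1 / ((k : ℝ) + 1) * ‖z‖ ^ 2) atTop (𝓝 (F x z)) := by
    simpa using (tendsto_one_div_add_atTop_nhds_zero_nat.mul_const (‖z‖ ^ 2)).const_add (F x z)
  refine le_of_tendsto_of_tendsto' h1 h2 fun k => ?_
  have hp : (0 : ℝ) < 1 / ((k : ℝ) + 1) := by positivity
  have := hy x _ hp z
  have h0 : 0 ≤ 1 / ((k : ℝ) + 1) * ‖y x (1 / ((k : ℝ) + 1))‖ ^ 2 := by positivity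
  linarith

/-- Measurable geometric median selectors exist in every dimension and for any number of points. -/
instance (m d : ℕ) : Nonempty (MedianSelector m d) := by
  suffices h : ∃ g : (Fin m → EuclideanSpace ℝ (Fin d)) → EuclideanSpace ℝ (Fin d),
      Measurable g ∧ ∀ v z, ∑ p, ‖g v - v p‖ ≤ ∑ p, ‖z - v p‖ by
    obtain ⟨g, hg, hmin⟩ := h
    exact ⟨⟨g, hg, hmin⟩⟩
  refine exists_measurable_minimizer
    (fun (v : Fin m → EuclideanSpace ℝ (Fin d)) y => ∑ p, ‖y - v p‖) ?_ ?_ ?_ ?_ m ?_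
  · intro v y z
    rw [← Finset.sum_add_distrib, Finset.sum_div]
    refine Finset.sum_le_sum fun p _ => ?_
    have : (1 / 2 : ℝ) • (y + z) - v p = (1 / 2 : ℝ) • ((y - v p) + (z - v p)) := by module
    rw [this, norm_smul, Real.norm_of_nonneg (by norm_num)]
    linarith [norm_add_le (y - v p) (z - v p)]
  · intro v; fun_prop
  · exact fun v y => Finset.sum_nonneg fun _ _ => norm_nonneg _
  · intro v
    rcases Nat.eq_zero_or_pos m with rfl | hm
    · exact ⟨0, by simp⟩
    · refine Continuous.exists_forall_le (by fun_prop) ?_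
      refine tendsto_atTop_mono (f := fun z => ‖z‖ - ‖v ⟨0, hm⟩‖) (fun z => ?_) ?_
      · refine (norm_sub_norm_le _ _).trans ?_
        exact Finset.single_le_sum (f := fun p => ‖z - v p‖) (fun _ _ => norm_nonneg _)
          (Finset.mem_univ _)
      · exact tendsto_atTop_add_const_right _ _ tendsto_norm_cocompact_atTop
  · intro v w y
    rw [← Finset.sum_sub_distrib]
    refine (Finset.abs_sum_le_sum_abs _ _).trans ?_
    have : ∀ p ∈ Finset.univ, |‖y - v p‖ - ‖y - w p‖| ≤ dist v w := fun p _ => by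
      refine (abs_norm_sub_norm_le _ _).trans ?_
      rw [sub_sub_sub_cancel_left, ← dist_eq_norm, dist_comm]
      exact dist_le_pi_dist v w p
    simpa using Finset.sum_le_sum this

/-! ### The mean estimation algorithm -/

/-- The number of blocks, `m = ⌈200 log (1/β)⌉`. -/
def numBlocks (β : ℝ) : ℕ := ⌈200 * Real.log (1 / β)⌉₊

/-- The noise variance `σ² = d c / (2 k² ε)`. -/
def noiseVariance (d k : ℕ) (c ε : ℝ) : ℝ := d * c / (2 * (k : ℝ) ^ 2 * ε)

/-- The average of the rows of the `p`-th block of length `k` (blocks and rows are counted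
from `0`). -/
def blockMean {n d : ℕ} (k : ℕ) (x : Fin n → EuclideanSpace ℝ (Fin d)) (p : ℕ) :
    EuclideanSpace ℝ (Fin d) :=
  (k : ℝ)⁻¹ • ∑ i ∈ Finset.univ.filter (fun i : Fin n => p * k ≤ (i : ℕ) ∧ (i : ℕ) < (p + 1) * k), x i

/-- The law of the noise `(Z_1, …, Z_m)`: i.i.d. with law `N(0, s I_d)`. -/
def noiseLaw (m d : ℕ) (s : ℝ) : Measure (Fin m → EuclideanSpace ℝ (Fin d)) :=
  Measure.pi fun _ => multivariateGaussian 0 (s • (1 : Matrix (Fin d) (Fin d) ℝ))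

instance (m d : ℕ) (s : ℝ) : IsProbabilityMeasure (noiseLaw m d s) := by
  unfold noiseLaw; infer_instance

theorem measurable_noisyMedian {n m d : ℕ} (k : ℕ) (G : MedianSelector m d) :
    Measurable fun q : (Fin n → EuclideanSpace ℝ (Fin d)) × (Fin m → EuclideanSpace ℝ (Fin d)) =>
      G.toFun fun p => blockMean k q.1 p + q.2 p := by
  refine G.measurable.comp (measurable_pi_lambda _ fun p => ?_)
  have h : Measurable fun x : Fin n → EuclideanSpace ℝ (Fin d) => blockMean k x p := by
    unfold blockMean; fun_prop
  exact (h.comp measurable_fst).add ((measurable_pi_apply p).comp measurable_snd)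

/-- The mean estimator as a randomized mechanism: with `m = numBlocks β` and `k = ⌊n / m⌋`, the
database `x` is mapped to the law of `G (blockMean_p x + Z_p)_{p < m}`, where the `Z_p` are
i.i.d. `N(0, σ² I_d)` and `G` selects a geometric median. -/
def meanEstimator {n d : ℕ} (c ε β : ℝ) (G : MedianSelector (numBlocks β) d) :
    Kernel (Fin n → EuclideanSpace ℝ (Fin d)) (EuclideanSpace ℝ (Fin d)) :=
  (Kernel.id ×ₖ Kernel.const _
      (noiseLaw (numBlocks β) d (noiseVariance d (n / numBlocks β) c ε))).map
    fun q => G.toFun fun p => blockMean (n / numBlocks β) q.1 p + q.2 p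

instance {n d : ℕ} (c ε β : ℝ) (G : MedianSelector (numBlocks β) d) :
    IsMarkovKernel (meanEstimator (n := n) c ε β G) :=
  Kernel.IsMarkovKernel.map _ (measurable_noisyMedian _ G)

theorem meanEstimator_apply {n d : ℕ} (c ε β : ℝ) (G : MedianSelector (numBlocks β) d)
    (x : Fin n → EuclideanSpace ℝ (Fin d)) :
    meanEstimator c ε β G x =
      (noiseLaw (numBlocks β) d (noiseVariance d (n / numBlocks β) c ε)).map
        fun z => G.toFun fun p => blockMean (n / numBlocks β) x p + z p := by
  rw [meanEstimator, Kernel.map_apply _ (measurable_noisyMedian _ G), Kernel.prod_apply,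
    Kernel.id_apply, Kernel.const_apply, Measure.dirac_prod,
    Measure.map_map (measurable_noisyMedian _ G) (by fun_prop)]
  rfl

end MIPrivacy

end

/-!
Privacy. For a fixed value `w` of the other rows, replacing the `i`-th row `x i` by a constant `e`
moves the vector of block means by at most `‖x i - e‖ / k`. The conditional mutual information is
at most the divergence of the joint law from the one in which the mechanism is run on the modified
database, since the latter output is a kernel in `w` alone and the conditional laws minimise this
divergence. Two Gaussians with the same covariance `σ² I` have divergence `‖shift‖² / (2 σ²)`, so
with `e` the mean of the row and post-processing by the median the information is at most
`c / (2 k² σ²) = ε / d`.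

Accuracy. The noisy block means are i.i.d. with mean `μ` and mean square error at most
`c / k + d σ²`, so Chebyshev makes each of them `α / 4`-far from `μ` with probability at most
`exp (-6)`. A Chernoff bound shows that a third of the `m` blocks are far with probability at most
`exp (-m) ≤ β`, and otherwise the geometric median is within `4 * (α / 4)` of `μ`.
-/

namespace MIPrivacy

open InformationTheory RealInnerProductSpace

section GaussianShift

section Laplace

variable {H : Type*} [NormedAddCommGroup H] [InnerProductSpace ℝ H] [CompleteSpace H]
  [SecondCountableTopology H] [MeasurableSpace H] [BorelSpace H]

/- The Laplace transform extends analytically to the imaginary axis, where it is the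
characteristic function. -/
theorem ext_of_integral_exp_inner {μ ν : Measure H} [IsProbabilityMeasure μ]
    [IsProbabilityMeasure ν]
    (hμ : ∀ a, Integrable (fun y => Real.exp ⟪a, y⟫) μ)
    (h : ∀ a, ∫ y, Real.exp ⟪a, y⟫ ∂μ = ∫ y, Real.exp ⟪a, y⟫ ∂ν) : μ = ν := by
  refine Measure.ext_of_charFun (funext fun a => ?_)
  have charFun_eq_complexMGF (ρ : Measure H) :
      charFun ρ a = complexMGF (fun y => ⟪a, y⟫) ρ Complex.I := by
    simp only [charFun_apply, complexMGF, real_inner_comm, mul_comm]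
  have hmgf : mgf (fun y => ⟪a, y⟫) μ = mgf (fun y => ⟪a, y⟫) ν := by
    funext s
    simpa only [mgf, real_inner_smul_left] using h (s • a)
  have hset : integrableExpSet (fun y => ⟪a, y⟫) μ = Set.univ :=
    Set.eq_univ_of_forall fun s => by
      simpa only [integrableExpSet, Set.mem_ofPred_eq, real_inner_smul_left] using hμ (s • a)
  rw [charFun_eq_complexMGF, charFun_eq_complexMGF]
  exact eqOn_complexMGF_of_mgf hmgf (by simp [hset])

end Laplace

variable {H : Type*} [NormedAddCommGroup H] [InnerProductSpace ℝ H] [FiniteDimensional ℝ H]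
  [MeasurableSpace H] [BorelSpace H]

theorem stdGaussian_map_inner (a : H) :
    (stdGaussian H).map (fun y => ⟪a, y⟫) = gaussianReal 0 (‖a‖ ^ 2).toNNReal := by
  have h := IsGaussian.map_eq_gaussianReal (μ := stdGaussian H) (innerSL ℝ a)
  rw [integral_strongDual_stdGaussian, variance_dual_stdGaussian, innerSL_apply_norm] at h
  exact h

theorem integrable_exp_inner_stdGaussian (a : H) :
    Integrable (fun y => Real.exp ⟪a, y⟫) (stdGaussian H) := by
  have h := integrable_exp_mul_gaussianReal (μ := 0) (v := (‖a‖ ^ 2).toNNReal) 1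
  rw [← stdGaussian_map_inner, integrable_map_measure (by fun_prop) (by fun_prop)] at h
  simpa only [Function.comp_def, one_mul] using h

theorem integral_exp_inner_stdGaussian (a : H) :
    ∫ y, Real.exp ⟪a, y⟫ ∂(stdGaussian H) = Real.exp (‖a‖ ^ 2 / 2) := by
  have h := mgf_gaussianReal (X := fun y => ⟪a, y⟫) (stdGaussian_map_inner a) 1
  simpa [mgf, Real.coe_toNNReal _ (sq_nonneg ‖a‖)] using h

theorem stdGaussian_map_add_const (a : H) :
    (stdGaussian H).map (fun y => y + a) = (stdGaussian H).tilted fun y => ⟪a, y⟫ := by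
  have : IsProbabilityMeasure ((stdGaussian H).map fun y => y + a) :=
    Measure.isProbabilityMeasure_map (by fun_prop)
  have := isProbabilityMeasure_tilted (integrable_exp_inner_stdGaussian a)
  refine ext_of_integral_exp_inner (fun b => ?_) fun b => ?_
  · rw [integrable_map_measure (by fun_prop) (by fun_prop)]
    simpa only [Function.comp_def, inner_add_right, Real.exp_add] using
      (integrable_exp_inner_stdGaussian b).mul_const _
  · rw [integral_map (by fun_prop) (by fun_prop), integral_exp_tilted]
    simp only [inner_add_right, Real.exp_add, Pi.add_apply, ← inner_add_left]
    rw [integral_mul_const, integral_exp_inner_stdGaussian, integral_exp_inner_stdGaussian,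
      integral_exp_inner_stdGaussian, ← Real.exp_add, ← Real.exp_sub, norm_add_sq_real,
      real_inner_comm]
    ring_nf

theorem stdGaussian_map_add_const_eq_withDensity (a : H) :
    (stdGaussian H).map (fun y => y + a) =
      (stdGaussian H).withDensity
        fun y => ENNReal.ofReal (Real.exp (⟪a, y⟫ - ‖a‖ ^ 2 / 2)) := by
  simp only [stdGaussian_map_add_const, Measure.tilted, integral_exp_inner_stdGaussian,
    Real.exp_sub]

variable {X : Type*} [MeasurableSpace X] {μ : Measure X}

theorem map_add_prod_stdGaussian_eq_withDensity {δ : X → H} (hδ : Measurable δ) :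
    (μ.prod (stdGaussian H)).map (fun q => (q.1, q.2 + δ q.1)) =
      (μ.prod (stdGaussian H)).withDensity
        fun q => ENNReal.ofReal (Real.exp (⟪δ q.1, q.2⟫ - ‖δ q.1‖ ^ 2 / 2)) := by
  refine Measure.ext_of_lintegral _ fun g hg => ?_
  rw [lintegral_map hg (by fun_prop), lintegral_withDensity_eq_lintegral_mul _ (by fun_prop) hg,
    lintegral_prod _ (by fun_prop), lintegral_prod _ (by fun_prop)]
  refine lintegral_congr fun x => ?_
  have hgx : Measurable fun y => g (x, y) := by fun_prop
  simp only [Pi.mul_apply]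
  rw [← lintegral_map (μ := stdGaussian H) (g := fun y => y + δ x) hgx (by fun_prop),
    stdGaussian_map_add_const_eq_withDensity,
    lintegral_withDensity_eq_lintegral_mul _ (by fun_prop) hgx]
  rfl

variable [IsProbabilityMeasure μ]

theorem klDiv_eq_of_eq_withDensity_exp {ν : Measure X} [IsProbabilityMeasure ν] {L : X → ℝ}
    (hL : Measurable L) (hν : ν = μ.withDensity fun x => ENNReal.ofReal (Real.exp (L x)))
    (hLν : Integrable L ν) : klDiv ν μ = ENNReal.ofReal (∫ x, L x ∂ν) := by
  have hac : ν ≪ μ := hν ▸ withDensity_absolutelyContinuous _ _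
  have hllr : llr ν μ =ᵐ[ν] L := by
    have hrn : ν.rnDeriv μ =ᵐ[μ] fun x => ENNReal.ofReal (Real.exp (L x)) :=
      hν ▸ Measure.rnDeriv_withDensity μ (by fun_prop)
    filter_upwards [hac.ae_le hrn] with x hx
    rw [llr, hx, ENNReal.toReal_ofReal (Real.exp_pos _).le, Real.log_exp]
  rw [klDiv_of_ac_of_integrable hac ((integrable_congr hllr).2 hLν), integral_congr_ae hllr]
  simp only [probReal_univ, add_sub_cancel_right]

theorem klDiv_map_add_prod_stdGaussian {δ : X → H} (hδ : Measurable δ) (hδ2 : MemLp δ 2 μ) :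
    klDiv ((μ.prod (stdGaussian H)).map fun q => (q.1, q.2 + δ q.1)) (μ.prod (stdGaussian H)) =
      ENNReal.ofReal (∫ x, ‖δ x‖ ^ 2 / 2 ∂μ) := by
  have hshift : Measurable fun q : X × H => (q.1, q.2 + δ q.1) := by fun_prop
  have : IsProbabilityMeasure
      ((μ.prod (stdGaussian H)).map fun q => (q.1, q.2 + δ q.1)) :=
    Measure.isProbabilityMeasure_map hshift.aemeasurable
  have logDensity_shift (q : X × H) : ⟪δ q.1, q.2 + δ q.1⟫ - ‖δ q.1‖ ^ 2 / 2 =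
      ⟪δ q.1, q.2⟫ + ‖δ q.1‖ ^ 2 / 2 := by
    rw [inner_add_right, real_inner_self_eq_norm_sq]
    ring
  have hδint : Integrable (fun x => ‖δ x‖ ^ 2 / 2) μ :=
    (hδ2.integrable_norm_pow two_ne_zero).div_const 2
  have hδint1 : Integrable δ μ := hδ2.integrable one_le_two
  have hcross : Integrable (fun q : X × H => ⟪δ q.1, q.2⟫) (μ.prod (stdGaussian H)) :=
    hδint1.op_fst_snd (by fun_prop) ⟨1, fun x y => by simpa using norm_inner_le_norm (𝕜 := ℝ) x y⟩
      IsGaussian.integrable_fun_id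
  have hcross_zero : ∫ q, ⟪δ q.1, q.2⟫ ∂(μ.prod (stdGaussian H)) = 0 := by
    have h := integral_prod_bilin (innerSL ℝ) hδint1
      (IsGaussian.integrable_fun_id (μ := stdGaussian H))
    rwa [integral_id_stdGaussian, map_zero] at h
  have hsum : Integrable (fun q : X × H => ⟪δ q.1, q.2⟫ + ‖δ q.1‖ ^ 2 / 2)
      (μ.prod (stdGaussian H)) := hcross.add (hδint.comp_fst _)
  have hlog : Measurable fun q : X × H => ⟪δ q.1, q.2⟫ - ‖δ q.1‖ ^ 2 / 2 := by fun_prop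
  have hlog_int : Integrable (fun q : X × H => ⟪δ q.1, q.2⟫ - ‖δ q.1‖ ^ 2 / 2)
      ((μ.prod (stdGaussian H)).map fun q => (q.1, q.2 + δ q.1)) :=
    (integrable_map_measure hlog.aestronglyMeasurable hshift.aemeasurable).2
      (hsum.congr (.of_forall fun q => (logDensity_shift q).symm))
  rw [klDiv_eq_of_eq_withDensity_exp hlog (map_add_prod_stdGaussian_eq_withDensity hδ) hlog_int,
    integral_map hshift.aemeasurable hlog.aestronglyMeasurable]
  simp only [logDensity_shift]
  rw [integral_add hcross (hδint.comp_fst _), hcross_zero, zero_add,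
    integral_fun_fst (fun x => ‖δ x‖ ^ 2 / 2), probReal_univ, one_smul]

/-- The Gaussian mechanism `x ↦ N(b x, σ² I)`. -/
noncomputable def gaussianMechanism (b : X → H) (hb : Measurable b) (σ : ℝ) : Kernel X H :=
  (Kernel.deterministic b hb ×ₖ Kernel.const X (stdGaussian H)).map fun q => q.1 + σ • q.2

instance (b : X → H) (hb : Measurable b) (σ : ℝ) : IsMarkovKernel (gaussianMechanism b hb σ) :=
  Kernel.IsMarkovKernel.map _ (by fun_prop)

theorem gaussianMechanism_apply (b : X → H) (hb : Measurable b) (σ : ℝ) (x : X) :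
    gaussianMechanism b hb σ x = (stdGaussian H).map fun z => b x + σ • z := by
  rw [gaussianMechanism, Kernel.map_apply _ (by fun_prop), Kernel.prod_apply,
    Kernel.deterministic_apply, Kernel.const_apply, Measure.dirac_prod,
    Measure.map_map (by fun_prop) (by fun_prop)]
  rfl

theorem compProd_gaussianMechanism (μ : Measure X) [IsProbabilityMeasure μ] (b : X → H)
    (hb : Measurable b) (σ : ℝ) :
    μ ⊗ₘ gaussianMechanism b hb σ =
      (μ.prod (stdGaussian H)).map fun q => (q.1, b q.1 + σ • q.2) := by
  refine Measure.ext_of_lintegral _ fun g hg => ?_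
  rw [Measure.lintegral_compProd hg, lintegral_map hg (by fun_prop),
    lintegral_prod _ (by fun_prop)]
  refine lintegral_congr fun x => ?_
  rw [gaussianMechanism_apply, lintegral_map (by fun_prop) (by fun_prop)]

theorem klDiv_compProd_gaussianMechanism_le {b b' : X → H} (hb : Measurable b)
    (hb' : Measurable b') (hbb' : MemLp (fun x => b x - b' x) 2 μ) {σ : ℝ} (hσ : σ ≠ 0) :
    klDiv (μ ⊗ₘ gaussianMechanism b hb σ) (μ ⊗ₘ gaussianMechanism b' hb' σ) ≤
      ENNReal.ofReal ((2 * σ ^ 2)⁻¹ * ∫ x, ‖b x - b' x‖ ^ 2 ∂μ) := by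
  have hshift : Measurable fun q : X × H => (q.1, q.2 + σ⁻¹ • (b q.1 - b' q.1)) := by fun_prop
  have : IsProbabilityMeasure
      ((μ.prod (stdGaussian H)).map fun q => (q.1, q.2 + σ⁻¹ • (b q.1 - b' q.1))) :=
    Measure.isProbabilityMeasure_map hshift.aemeasurable
  have hshifted : μ ⊗ₘ gaussianMechanism b hb σ =
      ((μ.prod (stdGaussian H)).map fun q => (q.1, q.2 + σ⁻¹ • (b q.1 - b' q.1))).map
        fun q => (q.1, b' q.1 + σ • q.2) := by
    rw [compProd_gaussianMechanism, Measure.map_map (by fun_prop) hshift]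
    congr 1 with q
    · rfl
    · simp only [Function.comp_apply, smul_add, smul_inv_smul₀ hσ]
      abel
  rw [hshifted, compProd_gaussianMechanism μ b' hb' σ]
  refine (klDiv_map_le _ _ (by fun_prop)).trans (le_of_eq ?_)
  rw [klDiv_map_add_prod_stdGaussian (δ := fun x => σ⁻¹ • (b x - b' x)) (by fun_prop)
    (hbb'.const_smul σ⁻¹), ← integral_const_mul]
  simp only [norm_smul, mul_pow, norm_inv, Real.norm_eq_abs, inv_pow, sq_abs, mul_inv]
  congr 2 with x
  ring

end GaussianShift

section Information

theorem klDiv_map_measurableEquiv {α β : Type*} [MeasurableSpace α] [MeasurableSpace β]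
    (e : α ≃ᵐ β) (μ ν : Measure α) [IsProbabilityMeasure μ] [IsProbabilityMeasure ν] :
    klDiv (μ.map e) (ν.map e) = klDiv μ ν := by
  refine (klDiv_map_le μ ν e.measurable).antisymm ?_
  have := Measure.isProbabilityMeasure_map (μ := μ) e.measurable.aemeasurable
  have := Measure.isProbabilityMeasure_map (μ := ν) e.measurable.aemeasurable
  simpa [Measure.map_map e.symm.measurable e.measurable] using
    klDiv_map_le (μ.map e) (ν.map e) e.symm.measurable

variable {Ω 𝓤 𝓥 𝓦 : Type*} [MeasurableSpace Ω]
  [MeasurableSpace 𝓤] [MeasurableSpace 𝓥] [MeasurableSpace 𝓦]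

theorem map_compProd_prod_swap (μ : Measure 𝓦) [SFinite μ] (A : Kernel 𝓦 𝓤)
    [IsSFiniteKernel A] (Q : Kernel 𝓦 𝓥) [IsSFiniteKernel Q] :
    (μ ⊗ₘ (A ×ₖ Q)).map (fun t => ((t.1, t.2.2), t.2.1)) =
      (μ ⊗ₘ Q) ⊗ₘ Kernel.prodMkRight 𝓥 A := by
  refine Measure.ext_of_lintegral _ fun g hg => ?_
  rw [lintegral_map hg (by fun_prop), Measure.lintegral_compProd (by fun_prop),
    Measure.lintegral_compProd hg, Measure.lintegral_compProd
      (f := fun p => ∫⁻ b, g (p, b) ∂Kernel.prodMkRight 𝓥 A p)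
      (Measurable.lintegral_kernel_prod_right' hg)]
  refine lintegral_congr fun w => ?_
  rw [Kernel.prod_apply, lintegral_prod_symm' _ (by fun_prop)]
  rfl

theorem map_comp_fst_compProd {X : Type*} [MeasurableSpace X] (μ : Measure X) [SFinite μ]
    (M : Kernel X 𝓥) [IsMarkovKernel M] {f : X → 𝓦} (hf : Measurable f) :
    (μ ⊗ₘ M).map (fun q => f q.1) = μ.map f := by
  conv_rhs => rw [← Measure.fst_compProd μ M]
  rw [Measure.fst, Measure.map_map hf measurable_fst]
  rfl

variable [StandardBorelSpace 𝓤] [Nonempty 𝓤]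

theorem map_compProd_condDistrib_prod (P : Measure Ω) [IsFiniteMeasure P] {U : Ω → 𝓤}
    {W : Ω → 𝓦} (hU : Measurable U) (hW : Measurable W) (Q : Kernel 𝓦 𝓥) [IsSFiniteKernel Q] :
    P.map W ⊗ₘ (condDistrib U W P ×ₖ Q) =
      (P ⊗ₘ Q.comap W hW).map fun q => (W q.1, U q.1, q.2) := by
  refine Measure.ext_of_lintegral _ fun g hg => ?_
  have hgQ : Measurable fun r : 𝓦 × 𝓤 => ∫⁻ v, g (r.1, r.2, v) ∂Q r.1 :=
    Measurable.lintegral_kernel_prod_right' (κ := Kernel.prodMkRight 𝓤 Q)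
      (f := fun s : (𝓦 × 𝓤) × 𝓥 => g (s.1.1, s.1.2, s.2)) (by fun_prop)
  calc ∫⁻ t, g t ∂(P.map W ⊗ₘ (condDistrib U W P ×ₖ Q))
      = ∫⁻ r, ∫⁻ v, g (r.1, r.2, v) ∂Q r.1 ∂(P.map W ⊗ₘ condDistrib U W P) := by
        rw [Measure.lintegral_compProd hg, Measure.lintegral_compProd hgQ]
        refine lintegral_congr fun w => ?_
        rw [Kernel.prod_apply, lintegral_prod _ (by fun_prop)]
    _ = ∫⁻ ω, ∫⁻ v, g (W ω, U ω, v) ∂Q (W ω) ∂P := by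
        rw [compProd_map_condDistrib hU.aemeasurable, lintegral_map hgQ (by fun_prop)]
    _ = ∫⁻ t, g t ∂((P ⊗ₘ Q.comap W hW).map fun q => (W q.1, U q.1, q.2)) := by
        rw [lintegral_map hg (by fun_prop), Measure.lintegral_compProd (by fun_prop)]
        rfl

theorem klDiv_compProd_condDistrib_prod (P : Measure Ω) [IsProbabilityMeasure P] {U : Ω → 𝓤}
    {V : Ω → 𝓥} {W : Ω → 𝓦} (hU : Measurable U) (hV : Measurable V) (hW : Measurable W)
    (Q : Kernel 𝓦 𝓥) [IsMarkovKernel Q] :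
    klDiv (P.map fun ω => (W ω, U ω, V ω)) (P.map W ⊗ₘ (condDistrib U W P ×ₖ Q)) =
      klDiv (P.map fun ω => (W ω, V ω)) (P.map W ⊗ₘ Q) +
        klDiv ((P.map fun ω => (W ω, V ω)) ⊗ₘ condDistrib U (fun ω => (W ω, V ω)) P)
          ((P.map fun ω => (W ω, V ω)) ⊗ₘ Kernel.prodMkRight 𝓥 (condDistrib U W P)) := by
  have : IsProbabilityMeasure (P.map W) := Measure.isProbabilityMeasure_map hW.aemeasurable
  have : IsProbabilityMeasure (P.map fun ω => (W ω, V ω)) :=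
    Measure.isProbabilityMeasure_map (by fun_prop)
  have : IsProbabilityMeasure (P.map fun ω => (W ω, U ω, V ω)) :=
    Measure.isProbabilityMeasure_map (by fun_prop)
  let swap : 𝓦 × 𝓤 × 𝓥 ≃ᵐ (𝓦 × 𝓥) × 𝓤 :=
    ((MeasurableEquiv.refl 𝓦).prodCongr MeasurableEquiv.prodComm).trans
      MeasurableEquiv.prodAssoc.symm
  have map_joint : (P.map fun ω => (W ω, U ω, V ω)).map swap =
      (P.map fun ω => (W ω, V ω)) ⊗ₘ condDistrib U (fun ω => (W ω, V ω)) P := by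
    rw [compProd_map_condDistrib hU.aemeasurable,
      Measure.map_map swap.measurable (by fun_prop)]
    rfl
  have map_surrogate : (P.map W ⊗ₘ (condDistrib U W P ×ₖ Q)).map swap =
      (P.map W ⊗ₘ Q) ⊗ₘ Kernel.prodMkRight 𝓥 (condDistrib U W P) :=
    map_compProd_prod_swap _ _ _
  rw [← klDiv_map_measurableEquiv swap, map_joint, map_surrogate, klDiv_compProd_eq_add]

variable [StandardBorelSpace 𝓥] [Nonempty 𝓥]

theorem klDiv_eq_klDiv_add_condMutualInfo (P : Measure Ω) [IsProbabilityMeasure P] {U : Ω → 𝓤}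
    {V : Ω → 𝓥} {W : Ω → 𝓦} (hU : Measurable U) (hV : Measurable V) (hW : Measurable W)
    (Q : Kernel 𝓦 𝓥) [IsMarkovKernel Q] :
    klDiv (P.map fun ω => (W ω, U ω, V ω)) (P.map W ⊗ₘ (condDistrib U W P ×ₖ Q)) =
      klDiv (P.map fun ω => (W ω, V ω)) (P.map W ⊗ₘ Q) + condMutualInfo P U V W := by
  have : IsProbabilityMeasure (P.map fun ω => (W ω, V ω)) :=
    Measure.isProbabilityMeasure_map (by fun_prop)
  rw [condMutualInfo, klDiv_compProd_condDistrib_prod P hU hV hW,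
    klDiv_compProd_condDistrib_prod P hU hV hW, compProd_map_condDistrib hV.aemeasurable,
    klDiv_self, zero_add]

theorem condMutualInfo_compProd_le {X : Type*} [MeasurableSpace X] (μ : Measure X)
    [IsProbabilityMeasure μ] (M : Kernel X 𝓥) [IsMarkovKernel M] {U : X → 𝓤} {W : X → 𝓦}
    (hU : Measurable U) (hW : Measurable W) (Q : Kernel 𝓦 𝓥) [IsMarkovKernel Q] :
    condMutualInfo (μ ⊗ₘ M) (fun q => U q.1) (fun q => q.2) (fun q => W q.1) ≤
      klDiv (μ ⊗ₘ M) (μ ⊗ₘ Q.comap W hW) := by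
  have hcond : condDistrib (fun q => U q.1) (fun q => W q.1) (μ ⊗ₘ M) = condDistrib U W μ := by
    simp only [condDistrib, map_comp_fst_compProd μ M (hW.prodMk hU)]
  have hsurrogate : (μ ⊗ₘ M).map (fun q => W q.1) ⊗ₘ
      (condDistrib (fun q => U q.1) (fun q => W q.1) (μ ⊗ₘ M) ×ₖ Q) =
      (μ ⊗ₘ Q.comap W hW).map fun q => (W q.1, U q.1, q.2) := by
    rw [map_comp_fst_compProd μ M hW, hcond, map_compProd_condDistrib_prod μ hU hW]
  calc condMutualInfo (μ ⊗ₘ M) (fun q => U q.1) (fun q => q.2) (fun q => W q.1)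
      ≤ klDiv ((μ ⊗ₘ M).map fun q => (W q.1, U q.1, q.2))
          ((μ ⊗ₘ Q.comap W hW).map fun q => (W q.1, U q.1, q.2)) := by
        rw [← hsurrogate, klDiv_eq_klDiv_add_condMutualInfo (μ ⊗ₘ M) (U := fun q => U q.1)
          (V := fun q => q.2) (W := fun q => W q.1) (by fun_prop) (by fun_prop) (by fun_prop)]
        exact le_add_self
    _ ≤ klDiv (μ ⊗ₘ M) (μ ⊗ₘ Q.comap W hW) := klDiv_map_le _ _ (by fun_prop)

end Information

section Privacy

theorem gaussianMechanism_map_apply {X 𝓥 H : Type*} [MeasurableSpace X] [MeasurableSpace 𝓥]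
    [NormedAddCommGroup H] [InnerProductSpace ℝ H] [FiniteDimensional ℝ H]
    [MeasurableSpace H] [BorelSpace H] {b : X → H} (hb : Measurable b) (σ : ℝ) {φ : H → 𝓥}
    (hφ : Measurable φ) (x : X) :
    (gaussianMechanism b hb σ).map φ x = (stdGaussian H).map fun z => φ (b x + σ • z) := by
  rw [Kernel.map_apply _ hφ, gaussianMechanism_apply, Measure.map_map hφ (by fun_prop)]
  rfl

theorem condMutualInfo_map_gaussianMechanism_le {X 𝓤 𝓥 𝓦 H : Type*} [MeasurableSpace X]
    [MeasurableSpace 𝓤] [StandardBorelSpace 𝓤] [Nonempty 𝓤]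
    [MeasurableSpace 𝓥] [StandardBorelSpace 𝓥] [Nonempty 𝓥] [MeasurableSpace 𝓦]
    [NormedAddCommGroup H] [InnerProductSpace ℝ H] [FiniteDimensional ℝ H]
    [MeasurableSpace H] [BorelSpace H] (μ : Measure X) [IsProbabilityMeasure μ]
    {U : X → 𝓤} {W : X → 𝓦} (hU : Measurable U) (hW : Measurable W)
    {b : X → H} {b' : 𝓦 → H} (hb : Measurable b) (hb' : Measurable b')
    (hbb' : MemLp (fun x => b x - b' (W x)) 2 μ) {σ : ℝ} (hσ : σ ≠ 0) {φ : H → 𝓥}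
    (hφ : Measurable φ) {M : Kernel X 𝓥} [IsMarkovKernel M]
    (hM : M = (gaussianMechanism b hb σ).map φ) :
    condMutualInfo (μ ⊗ₘ M) (fun q => U q.1) (fun q => q.2) (fun q => W q.1) ≤
      ENNReal.ofReal ((2 * σ ^ 2)⁻¹ * ∫ x, ‖b x - b' (W x)‖ ^ 2 ∂μ) := by
  have : IsMarkovKernel ((gaussianMechanism b' hb' σ).map φ) := Kernel.IsMarkovKernel.map _ hφ
  have hcomap : ((gaussianMechanism b' hb' σ).map φ).comap W hW =
      (gaussianMechanism (fun x => b' (W x)) (hb'.comp hW) σ).map φ := by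
    ext1 x
    rw [Kernel.comap_apply, Kernel.map_apply _ hφ, Kernel.map_apply _ hφ,
      gaussianMechanism_apply, gaussianMechanism_apply]
  calc condMutualInfo (μ ⊗ₘ M) (fun q => U q.1) (fun q => q.2) (fun q => W q.1)
      ≤ klDiv (μ ⊗ₘ M) (μ ⊗ₘ ((gaussianMechanism b' hb' σ).map φ).comap W hW) :=
        condMutualInfo_compProd_le μ M hU hW _
    _ ≤ klDiv (μ ⊗ₘ gaussianMechanism b hb σ)
          (μ ⊗ₘ gaussianMechanism (fun x => b' (W x)) (hb'.comp hW) σ) := by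
        rw [hM, hcomap, Measure.compProd_map hφ, Measure.compProd_map hφ]
        exact klDiv_map_le _ _ (by fun_prop)
    _ ≤ ENNReal.ofReal ((2 * σ ^ 2)⁻¹ * ∫ x, ‖b x - b' (W x)‖ ^ 2 ∂μ) :=
        klDiv_compProd_gaussianMechanism_le hb (hb'.comp hW) hbb' hσ

theorem pi_stdGaussian_map_toLp (ι E : Type*) [Fintype ι] [NormedAddCommGroup E]
    [InnerProductSpace ℝ E] [FiniteDimensional ℝ E] [MeasurableSpace E] [BorelSpace E] :
    (Measure.pi fun _ : ι => stdGaussian E).map (WithLp.toLp 2) =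
      stdGaussian (PiLp 2 fun _ : ι => E) := by
  refine Measure.ext_of_charFun (funext fun t => ?_)
  simp_rw [charFun_pi, charFun_stdGaussian, ← Complex.exp_sum, ← Complex.ofReal_pow,
    PiLp.norm_sq_eq_of_L2]
  simp [Finset.sum_div, neg_div]

theorem multivariateGaussian_smul_one (d : ℕ) {s : ℝ} (hs : 0 ≤ s) :
    multivariateGaussian 0 (s • (1 : Matrix (Fin d) (Fin d) ℝ)) =
      (stdGaussian (EuclideanSpace ℝ (Fin d))).map fun z => √s • z := by
  refine Measure.ext_of_charFun (funext fun t => ?_)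
  have hquad : t.ofLp ⬝ᵥ t.ofLp = ‖t‖ ^ 2 := by
    rw [EuclideanSpace.real_norm_sq_eq]
    simp only [dotProduct, sq]
  rw [charFun_multivariateGaussian (Matrix.PosSemidef.one.smul hs), charFun_map_smul,
    charFun_stdGaussian, norm_smul, ← Complex.ofReal_pow, mul_pow,
    Real.norm_of_nonneg (Real.sqrt_nonneg _), Real.sq_sqrt hs, inner_zero_right,
    Matrix.smul_mulVec, Matrix.one_mulVec, dotProduct_smul, hquad, smul_eq_mul]
  push_cast
  ring_nf

theorem noiseLaw_eq_map_stdGaussian (m d : ℕ) {s : ℝ} (hs : 0 ≤ s) :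
    noiseLaw m d s = (stdGaussian (PiLp 2 fun _ : Fin m => EuclideanSpace ℝ (Fin d))).map
      fun z p => √s • z p := by
  rw [← pi_stdGaussian_map_toLp, Measure.map_map (by fun_prop) (by fun_prop), noiseLaw,
    multivariateGaussian_smul_one d hs]
  exact (Measure.pi_map_pi fun _ => by fun_prop).symm

variable {n d : ℕ}

theorem measurable_blockMean (k p : ℕ) :
    Measurable fun x : Fin n → EuclideanSpace ℝ (Fin d) => blockMean k x p := by
  unfold blockMean
  fun_prop

theorem measurable_toLp_blockMean (m k : ℕ) :
    Measurable fun x : Fin n → EuclideanSpace ℝ (Fin d) =>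
      WithLp.toLp 2 fun p : Fin m => blockMean k x p :=
  (WithLp.measurable_toLp 2 _).comp (measurable_pi_lambda _ fun p => measurable_blockMean k p)

theorem meanEstimator_eq_map_gaussianMechanism {c ε β : ℝ}
    (hs : 0 ≤ noiseVariance d (n / numBlocks β) c ε) (G : MedianSelector (numBlocks β) d) :
    meanEstimator (n := n) c ε β G =
      (gaussianMechanism _ (measurable_toLp_blockMean (numBlocks β) (n / numBlocks β))
        √(noiseVariance d (n / numBlocks β) c ε)).map fun y => G.toFun y.ofLp := by
  have hG : Measurable fun y : PiLp 2 fun _ : Fin (numBlocks β) => EuclideanSpace ℝ (Fin d) =>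
      G.toFun y.ofLp := G.measurable.comp (WithLp.measurable_ofLp 2 _)
  have hmedian (x : Fin n → EuclideanSpace ℝ (Fin d)) :
      Measurable fun z : Fin (numBlocks β) → EuclideanSpace ℝ (Fin d) =>
        G.toFun fun p => blockMean (n / numBlocks β) x p + z p := G.measurable.comp (by fun_prop)
  ext1 x
  rw [meanEstimator_apply, noiseLaw_eq_map_stdGaussian _ _ hs, gaussianMechanism_map_apply _ _ hG,
    Measure.map_map (hmedian x) (by fun_prop)]
  rfl

theorem measurable_funSplitAt_symm {E : Type*} [MeasurableSpace E] (i : Fin n) (e : E) :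
    Measurable fun w => (Equiv.funSplitAt i E).symm (e, w) := by
  refine measurable_pi_lambda _ fun j => ?_
  by_cases hj : j = i
  · simp [hj]
  · simpa [hj] using measurable_pi_apply _

theorem funSplitAt_symm_restrict {E : Type*} (i : Fin n) (e : E) (x : Fin n → E) :
    (Equiv.funSplitAt i E).symm (e, fun j : {j : Fin n // j ≠ i} => x j) =
      Function.update x i e := by
  ext j
  simp [Function.update_apply]

theorem blockMean_sub_blockMean_update (k : ℕ) (x : Fin n → EuclideanSpace ℝ (Fin d)) (i : Fin n)
    (e : EuclideanSpace ℝ (Fin d)) (p : ℕ) :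
    blockMean k x p - blockMean k (Function.update x i e) p =
      if p * k ≤ (i : ℕ) ∧ (i : ℕ) < (p + 1) * k then (k : ℝ)⁻¹ • (x i - e) else 0 := by
  have hrow (j : Fin n) : x j - Function.update x i e j = if j = i then x i - e else 0 := by
    by_cases hj : j = i
    · simp [hj]
    · simp [hj]
  rw [blockMean, blockMean, ← smul_sub, ← Finset.sum_sub_distrib]
  simp_rw [hrow, Finset.sum_ite_eq', Finset.mem_filter_univ]
  split_ifs <;> simp

theorem norm_toLp_blockMean_sub_sq_le (m k : ℕ) (x : Fin n → EuclideanSpace ℝ (Fin d))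
    (i : Fin n) (e : EuclideanSpace ℝ (Fin d)) :
    ‖(WithLp.toLp 2 fun p : Fin m => blockMean k x p) -
        WithLp.toLp 2 fun p : Fin m => blockMean k (Function.update x i e) p‖ ^ 2 ≤
      ((k : ℝ)⁻¹ * ‖x i - e‖) ^ 2 := by
  rw [PiLp.norm_sq_eq_of_L2]
  simp_rw [PiLp.sub_apply, blockMean_sub_blockMean_update]
  have block_unique (p : Fin m) (hp : (p : ℕ) * k ≤ i ∧ (i : ℕ) < (p + 1) * k) :
      (p : ℕ) = i / k := (Nat.div_eq_of_lt_le hp.1 hp.2).symm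
  by_cases hex : ∃ p : Fin m, (p : ℕ) * k ≤ i ∧ (i : ℕ) < (p + 1) * k
  · obtain ⟨p, hp⟩ := hex
    rw [Fintype.sum_eq_single p fun q hqp => ?_]
    · simp [if_pos hp, norm_smul]
    · rw [if_neg fun hq => hqp (Fin.ext ((block_unique q hq).trans (block_unique p hp).symm))]
      simp
  · rw [Finset.sum_eq_zero fun p _ => ?_]
    · positivity
    · rw [if_neg fun hp => hex ⟨p, hp⟩]
      simp

theorem condMutualInfo_meanEstimator_le {c ε β : ℝ}
    (hs : 0 < noiseVariance d (n / numBlocks β) c ε) (G : MedianSelector (numBlocks β) d)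
    (μ : Measure (Fin n → EuclideanSpace ℝ (Fin d))) [IsProbabilityMeasure μ] (i : Fin n)
    (hμ : MemLp (fun x => x i) 2 μ) (e : EuclideanSpace ℝ (Fin d)) :
    condMutualInfo (μ ⊗ₘ meanEstimator c ε β G)
        (fun q => q.1 i) (fun q => q.2) (fun q => fun j : {j : Fin n // j ≠ i} => q.1 j) ≤
      ENNReal.ofReal ((2 * noiseVariance d (n / numBlocks β) c ε *
        ((n / numBlocks β : ℕ) : ℝ) ^ 2)⁻¹ * ∫ x, ‖x i - e‖ ^ 2 ∂μ) := by
  have hmech := meanEstimator_eq_map_gaussianMechanism hs.le G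
  generalize n / numBlocks β = k at *
  let b (x : Fin n → EuclideanSpace ℝ (Fin d)) : PiLp 2 fun _ : Fin (numBlocks β) => _ :=
    WithLp.toLp 2 fun p => blockMean k x p
  let W (x : Fin n → EuclideanSpace ℝ (Fin d)) (j : {j : Fin n // j ≠ i}) := x j
  let b' (w : {j : Fin n // j ≠ i} → EuclideanSpace ℝ (Fin d)) :=
    b ((Equiv.funSplitAt i _).symm (e, w))
  have hb : Measurable b := measurable_toLp_blockMean _ k
  have hb' : Measurable b' := hb.comp (measurable_funSplitAt_symm i e)
  have hW : Measurable W := by fun_prop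
  have hrow : MemLp (fun x => x i - e) 2 μ := hμ.sub (memLp_const e)
  have hsens (x : Fin n → EuclideanSpace ℝ (Fin d)) :
      ‖b x - b' (W x)‖ ^ 2 ≤ ((k : ℝ)⁻¹ * ‖x i - e‖) ^ 2 := by
    simpa only [b', W, funSplitAt_symm_restrict] using norm_toLp_blockMean_sub_sq_le _ k x i e
  have hbb' : MemLp (fun x => b x - b' (W x)) 2 μ :=
    hrow.of_le_mul (by fun_prop) (.of_forall fun x =>
      le_of_sq_le_sq (hsens x) (by positivity))
  refine (condMutualInfo_map_gaussianMechanism_le μ (measurable_pi_apply i) hW hb hb' hbb'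
    (Real.sqrt_ne_zero'.2 hs) (G.measurable.comp (WithLp.measurable_ofLp 2 _)) hmech).trans
    (ENNReal.ofReal_le_ofReal ?_)
  calc (2 * √(noiseVariance d k c ε) ^ 2)⁻¹ * ∫ x, ‖b x - b' (W x)‖ ^ 2 ∂μ
      ≤ (2 * noiseVariance d k c ε)⁻¹ * ∫ x, ((k : ℝ)⁻¹ * ‖x i - e‖) ^ 2 ∂μ := by
        rw [Real.sq_sqrt hs.le]
        refine mul_le_mul_of_nonneg_left (integral_mono
          (hbb'.integrable_norm_pow two_ne_zero) ?_ hsens) (by positivity)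
        exact (hrow.norm.const_mul (k : ℝ)⁻¹).integrable_sq
    _ = (2 * noiseVariance d k c ε * (k : ℝ) ^ 2)⁻¹ * ∫ x, ‖x i - e‖ ^ 2 ∂μ := by
        simp_rw [mul_pow, integral_const_mul, mul_inv, inv_pow, mul_assoc]

theorem isMIDP_meanEstimator {c ε β : ℝ} (hd : 1 ≤ d) (hc : 0 < c) (hε : 0 < ε)
    (hk : 0 < n / numBlocks β) (G : MedianSelector (numBlocks β) d) :
    IsMIDP (meanEstimator (n := n) c ε β G) ε (secondMomentClass n d c) := by
  refine iSup₂_le fun P hP => iSup_le fun i => ?_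
  obtain ⟨hmem, hvar⟩ := hP i
  have hk' : (0 : ℝ) < (n / numBlocks β : ℕ) := by exact_mod_cast hk
  have hd' : (1 : ℝ) ≤ d := by exact_mod_cast hd
  have hs : 0 < noiseVariance d (n / numBlocks β) c ε := by
    rw [noiseVariance]
    positivity
  refine (condMutualInfo_meanEstimator_le hs G P i hmem _).trans
    (ENNReal.ofReal_le_ofReal ((mul_le_mul_of_nonneg_left hvar (by positivity)).trans ?_))
  calc _ = ε / d := by
        rw [noiseVariance]
        field_simp
    _ ≤ ε := div_le_self hε.le hd'

end Privacy

section GeometricMedian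

variable {ι E : Type*} [Fintype ι] [SeminormedAddCommGroup E]

/- Moving from `a` to `y` saves at most `‖y - a‖` on each far point and loses at least
`‖y - a‖ - 2 r` on each near point, and at least two thirds of the points are near. -/
theorem norm_sub_le_of_sum_norm_sub_le {v : ι → E} {y a : E} {r : ℝ}
    (hy : ∑ p, ‖y - v p‖ ≤ ∑ p, ‖a - v p‖)
    (hfar : 3 * (Finset.univ.filter fun p => r < ‖v p - a‖).card < Fintype.card ι) :
    ‖y - a‖ ≤ 4 * r := by
  let far := Finset.univ.filter fun p => r < ‖v p - a‖
  let near := Finset.univ.filter fun p => ¬ r < ‖v p - a‖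
  have hcard : far.card + near.card = Fintype.card ι :=
    Finset.card_filter_add_card_filter_not _
  have hfar_ge : (far.card : ℝ) * -‖y - a‖ ≤ ∑ p ∈ far, (‖y - v p‖ - ‖a - v p‖) := by
    rw [← nsmul_eq_mul]
    refine Finset.card_nsmul_le_sum _ _ _ fun p _ => ?_
    linarith [norm_sub_le_norm_sub_add_norm_sub a y (v p), norm_sub_rev a y]
  have hnear_ge : (near.card : ℝ) * (‖y - a‖ - 2 * r) ≤
      ∑ p ∈ near, (‖y - v p‖ - ‖a - v p‖) := by
    rw [← nsmul_eq_mul]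
    refine Finset.card_nsmul_le_sum _ _ _ fun p hp => ?_
    have hp' : ‖v p - a‖ ≤ r := not_lt.1 (Finset.mem_filter.1 hp).2
    linarith [norm_sub_le_norm_sub_add_norm_sub y (v p) a, norm_sub_rev a (v p)]
  have hsum : ∑ p ∈ far, (‖y - v p‖ - ‖a - v p‖) + ∑ p ∈ near, (‖y - v p‖ - ‖a - v p‖) ≤ 0 := by
    rw [Finset.sum_filter_add_sum_filter_not, Finset.sum_sub_distrib]
    linarith
  have hfar' : 3 * far.card < Fintype.card ι := hfar
  have htwo : (2 : ℝ) * far.card ≤ near.card := by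
    norm_cast
    omega
  have hpos : (0 : ℝ) < near.card := by
    norm_cast
    omega
  have hmul : 2 * (far.card : ℝ) * ‖y - a‖ ≤ near.card * ‖y - a‖ :=
    mul_le_mul_of_nonneg_right htwo (norm_nonneg _)
  refine le_of_mul_le_mul_left ?_ hpos
  linarith

end GeometricMedian

section Concentration

theorem integral_exp_mul_indicator_le {Y : Type*} [MeasurableSpace Y] (Q : Measure Y)
    [IsProbabilityMeasure Q] {A : Set Y} (hA : MeasurableSet A) (t : ℝ) :
    ∫ y, Real.exp (t * A.indicator 1 y) ∂Q ≤ Real.exp (Q.real A * Real.exp t) := by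
  have hsplit (y : Y) :
      Real.exp (t * A.indicator 1 y) = 1 + A.indicator (fun _ => Real.exp t - 1) y := by
    by_cases hy : y ∈ A <;> simp [hy]
  calc ∫ y, Real.exp (t * A.indicator 1 y) ∂Q = 1 + Q.real A * (Real.exp t - 1) := by
        simp_rw [hsplit]
        rw [integral_add (integrable_const _) ((integrable_const _).indicator hA),
          integral_const, integral_indicator_const _ hA]
        simp
    _ ≤ Q.real A * Real.exp t + 1 := by
        linarith [measureReal_nonneg (μ := Q) (s := A)]
    _ ≤ Real.exp (Q.real A * Real.exp t) := Real.add_one_le_exp _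

variable {ι Y : Type*} [Fintype ι] [MeasurableSpace Y] (Q : Measure Y) [IsProbabilityMeasure Q]

theorem measureReal_pi_le_card_filter_mem_le {A : Set Y} [DecidablePred (· ∈ A)]
    (hA : MeasurableSet A) {t : ℝ} (ht : 0 ≤ t) (u : ℝ) :
    (Measure.pi fun _ : ι => Q).real {v | u ≤ (Finset.univ.filter fun p => v p ∈ A).card} ≤
      Real.exp (Fintype.card ι * (Q.real A * Real.exp t) - t * u) := by
  let N (p : ι) (v : ι → Y) : ℝ := A.indicator 1 (v p)
  have hind : Measurable (A.indicator (1 : Y → ℝ)) := measurable_one.indicator hA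
  have hN (p : ι) : Measurable (N p) := hind.comp (measurable_pi_apply p)
  have hsum : Measurable (∑ p, N p) := by
    simpa only [Finset.sum_fn] using Finset.measurable_sum _ fun p _ => hN p
  have hcard (v : ι → Y) : ((Finset.univ.filter fun p => v p ∈ A).card : ℝ) = (∑ p, N p) v := by
    simp [N, Set.indicator_apply]
  have hindep : iIndepFun N (Measure.pi fun _ => Q) := iIndepFun_pi fun _ => hind.aemeasurable
  have hle (v : ι → Y) : (∑ p, N p) v ≤ Fintype.card ι := by
    rw [← hcard]
    exact_mod_cast Finset.card_le_univ _
  have hmgf (p : ι) : mgf (N p) (Measure.pi fun _ => Q) t ≤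
      Real.exp (Q.real A * Real.exp t) :=
    (integral_comp_eval (μ := fun _ : ι => Q) (i := p)
      (f := fun y => Real.exp (t * A.indicator 1 y)) (by fun_prop)).trans_le
      (integral_exp_mul_indicator_le Q hA t)
  simp_rw [hcard]
  calc (Measure.pi fun _ => Q).real {v | u ≤ (∑ p, N p) v}
      ≤ Real.exp (-t * u) * mgf (∑ p, N p) (Measure.pi fun _ => Q) t :=
        measure_ge_le_exp_mul_mgf u ht (integrable_exp_mul_of_le t _ ht
          hsum.aemeasurable (.of_forall hle))
    _ ≤ Real.exp (-t * u) * ∏ _p : ι, Real.exp (Q.real A * Real.exp t) := by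
        rw [hindep.mgf_sum hN]
        gcongr with p
        · exact fun p _ => mgf_nonneg
        · exact hmgf p
    _ = Real.exp (Fintype.card ι * (Q.real A * Real.exp t) - t * u) := by
        rw [Finset.prod_const, Finset.card_univ, ← Real.exp_nat_mul, ← Real.exp_add]
        ring_nf

theorem measureReal_pi_lt_norm_sub_le {E : Type*} [NormedAddCommGroup E] [MeasurableSpace E]
    [BorelSpace E] [SecondCountableTopology E] (Q : Measure E) [IsProbabilityMeasure Q]
    {G : (ι → E) → E} {a : E} (hG : ∀ v, ∑ p, ‖G v - v p‖ ≤ ∑ p, ‖a - v p‖) {r : ℝ}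
    (hQ : Q.real {x | r < ‖x - a‖} ≤ Real.exp (-6)) :
    (Measure.pi fun _ : ι => Q).real {v | 4 * r < ‖G v - a‖} ≤ Real.exp (-Fintype.card ι) := by
  have hA : MeasurableSet {x | r < ‖x - a‖} := measurableSet_lt (by fun_prop) (by fun_prop)
  have hsub : {v | 4 * r < ‖G v - a‖} ⊆ {v : ι → E | (Fintype.card ι / 3 : ℝ) ≤
      (Finset.univ.filter fun p => v p ∈ {x | r < ‖x - a‖}).card} := by
    intro v hv
    by_contra hfew
    refine not_le.2 hv (norm_sub_le_of_sum_norm_sub_le (hG v) ?_)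
    rw [Set.mem_ofPred_eq, not_le, lt_div_iff₀' three_pos] at hfew
    exact_mod_cast hfew
  refine (measureReal_mono hsub).trans
    ((measureReal_pi_le_card_filter_mem_le Q hA (t := 6) (by norm_num) _).trans
      (Real.exp_le_exp.2 ?_))
  have hexp : Q.real {x | r < ‖x - a‖} * Real.exp 6 ≤ 1 := by
    calc _ ≤ Real.exp (-6) * Real.exp 6 := by gcongr
      _ = 1 := by rw [← Real.exp_add, neg_add_cancel, Real.exp_zero]
  linarith [mul_le_mul_of_nonneg_left hexp (Nat.cast_nonneg (α := ℝ) (Fintype.card ι))]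

theorem measureReal_lt_norm_le {Ω E : Type*} [MeasurableSpace Ω] [NormedAddCommGroup E]
    (P : Measure Ω) [IsFiniteMeasure P] {f : Ω → E} (hf : MemLp f 2 P) {r : ℝ} (hr : 0 < r) :
    P.real {ω | r < ‖f ω‖} ≤ (∫ ω, ‖f ω‖ ^ 2 ∂P) / r ^ 2 := by
  rw [le_div_iff₀ (by positivity), mul_comm]
  calc r ^ 2 * P.real {ω | r < ‖f ω‖} ≤ r ^ 2 * P.real {ω | r ^ 2 ≤ ‖f ω‖ ^ 2} :=
        mul_le_mul_of_nonneg_left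
          (measureReal_mono fun ω (hω : r < ‖f ω‖) =>
            show r ^ 2 ≤ ‖f ω‖ ^ 2 from pow_le_pow_left₀ hr.le hω.le 2) (sq_nonneg r)
    _ ≤ ∫ ω, ‖f ω‖ ^ 2 ∂P := mul_meas_ge_le_integral_of_nonneg
        (.of_forall fun ω => sq_nonneg _) (hf.integrable_norm_pow two_ne_zero) _

end Concentration

section Variance

variable {Ω E : Type*} [MeasurableSpace Ω] {P : Measure Ω} [NormedAddCommGroup E]
  [InnerProductSpace ℝ E] [CompleteSpace E] [MeasurableSpace E] [BorelSpace E]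

theorem integral_norm_add_sq_of_indepFun [IsFiniteMeasure P] {X Y : Ω → E} (hX : MemLp X 2 P)
    (hY : MemLp Y 2 P) (hXY : IndepFun X Y P) (hY0 : ∫ ω, Y ω ∂P = 0) :
    ∫ ω, ‖X ω + Y ω‖ ^ 2 ∂P = ∫ ω, ‖X ω‖ ^ 2 ∂P + ∫ ω, ‖Y ω‖ ^ 2 ∂P := by
  have hXi : Integrable X P := hX.integrable one_le_two
  have hYi : Integrable Y P := hY.integrable one_le_two
  have hcross : ∫ ω, ⟪X ω, Y ω⟫ ∂P = 0 :=
    (hXY.integral_bilin hXi hYi (innerSL ℝ)).trans (by rw [hY0, map_zero])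
  have hcrossi : Integrable (fun ω => ⟪X ω, Y ω⟫) P := hXY.integrable_bilin hXi hYi (innerSL ℝ)
  have hXsq : Integrable (fun ω => ‖X ω‖ ^ 2) P := hX.integrable_norm_pow two_ne_zero
  have hYsq : Integrable (fun ω => ‖Y ω‖ ^ 2) P := hY.integrable_norm_pow two_ne_zero
  have hadd : Integrable (fun ω => ‖X ω‖ ^ 2 + 2 * ⟪X ω, Y ω⟫) P := hXsq.add (hcrossi.const_mul 2)
  simp_rw [norm_add_sq_real]
  rw [integral_add hadd hYsq, integral_add hXsq (hcrossi.const_mul 2), integral_const_mul, hcross,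
    mul_zero, add_zero]

theorem integral_norm_sum_sq_of_iIndepFun [IsFiniteMeasure P] [SecondCountableTopology E]
    {ι : Type*} {X : ι → Ω → E} (hX : ∀ i, MemLp (X i) 2 P) (hindep : iIndepFun X P)
    (hX0 : ∀ i, ∫ ω, X i ω ∂P = 0) (s : Finset ι) :
    ∫ ω, ‖∑ i ∈ s, X i ω‖ ^ 2 ∂P = ∑ i ∈ s, ∫ ω, ‖X i ω‖ ^ 2 ∂P := by
  classical
  induction s using Finset.induction_on with
  | empty => simp
  | insert i s hi ih =>
    have hs : MemLp (∑ j ∈ s, X j) 2 P := memLp_finsetSum' s fun j _ => hX j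
    have hadd := integral_norm_add_sq_of_indepFun hs (hX i)
      (hindep.indepFun_finsetSum_of_notMem₀ (fun j => (hX j).1.aemeasurable) hi) (hX0 i)
    simp only [Finset.sum_apply] at hadd
    simp_rw [Finset.sum_insert hi, add_comm (X i _)]
    rw [hadd, ih, add_comm]

theorem integral_norm_sq_stdGaussian (E : Type*) [NormedAddCommGroup E] [InnerProductSpace ℝ E]
    [FiniteDimensional ℝ E] [MeasurableSpace E] [BorelSpace E] :
    ∫ z, ‖z‖ ^ 2 ∂stdGaussian E = Module.finrank ℝ E := by
  let b := stdOrthonormalBasis ℝ E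
  have hcoord (i : Fin (Module.finrank ℝ E)) : ∫ z, ⟪b i, z⟫ ^ 2 ∂stdGaussian E = 1 := by
    have hvar := variance_dual_stdGaussian (innerSL ℝ (b i))
    rw [variance_of_integral_eq_zero (by fun_prop) (integral_strongDual_stdGaussian _),
      innerSL_apply_norm, b.norm_eq_one, one_pow] at hvar
    exact hvar
  have hint (i : Fin (Module.finrank ℝ E)) :
      Integrable (fun z => ⟪b i, z⟫ ^ 2) (stdGaussian E) :=
    ((innerSL ℝ (b i)).comp_memLp' IsGaussian.memLp_two_id).integrable_sq
  simp_rw [← b.sum_sq_inner_right]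
  rw [integral_finsetSum _ fun i _ => hint i]
  simp [hcoord]

end Variance

section NoisyMean

variable {E : Type*} [NormedAddCommGroup E] [MeasurableSpace E]

/-- The law of the mean of `k` independent samples of `P` plus an independent noise of law `N`:
the common law of the noisy block means of the estimator. -/
noncomputable def noisyMeanLaw [NormedSpace ℝ E] (P N : Measure E) (k : ℕ) : Measure E :=
  ((Measure.pi fun _ : Fin k => P).prod N).map fun q => (k : ℝ)⁻¹ • ∑ r, q.1 r + q.2

variable (P N : Measure E) [IsProbabilityMeasure P] [IsProbabilityMeasure N]

theorem memLp_mean [NormedSpace ℝ E] {k : ℕ} (hP : MemLp id 2 P) :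
    MemLp (fun y : Fin k → E => (k : ℝ)⁻¹ • ∑ r, y r) 2 (Measure.pi fun _ => P) :=
  (memLp_finsetSum _ fun r _ =>
    hP.comp_measurePreserving (measurePreserving_eval (fun _ : Fin k => P) r)).const_smul _

variable [BorelSpace E] [SecondCountableTopology E]

instance isProbabilityMeasure_noisyMeanLaw [NormedSpace ℝ E] (k : ℕ) :
    IsProbabilityMeasure (noisyMeanLaw P N k) :=
  Measure.isProbabilityMeasure_map (by fun_prop)

theorem memLp_noisyMeanLaw [NormedSpace ℝ E] (k : ℕ) (hP : MemLp id 2 P) (hN : MemLp id 2 N) :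
    MemLp id 2 (noisyMeanLaw P N k) :=
  (memLp_map_measure_iff aestronglyMeasurable_id (by fun_prop)).2
    (((memLp_mean P hP).comp_fst N).add (hN.comp_snd _))

variable [InnerProductSpace ℝ E] [CompleteSpace E]

theorem integral_norm_mean_sub_sq {k : ℕ} (hk : k ≠ 0) (hP : MemLp id 2 P) :
    ∫ y, ‖(k : ℝ)⁻¹ • ∑ r, y r - ∫ x, x ∂P‖ ^ 2 ∂(Measure.pi fun _ : Fin k => P) =
      (k : ℝ)⁻¹ * ∫ x, ‖x - ∫ x', x' ∂P‖ ^ 2 ∂P := by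
  have hk' : (k : ℝ) ≠ 0 := Nat.cast_ne_zero.2 hk
  set a := ∫ x, x ∂P
  have hcen : MemLp (fun x => x - a) 2 P := hP.sub (memLp_const a)
  have hcen0 : ∫ x, (x - a) ∂P = 0 := by
    have hPi : Integrable (fun x => x) P := hP.integrable one_le_two
    rw [integral_sub hPi (integrable_const a), integral_const, probReal_univ, one_smul, sub_self]
  have hsplit (y : Fin k → E) : (k : ℝ)⁻¹ • ∑ r, y r - a = (k : ℝ)⁻¹ • ∑ r, (y r - a) := by
    simp [Finset.sum_sub_distrib, smul_sub, ← Nat.cast_smul_eq_nsmul ℝ, smul_smul, hk']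
  have hsum := integral_norm_sum_sq_of_iIndepFun (P := Measure.pi fun _ : Fin k => P)
    (X := fun r y => y r - a)
    (fun r => hcen.comp_measurePreserving (measurePreserving_eval _ r))
    (iIndepFun_pi (X := fun _ x => x - a) fun _ => by fun_prop)
    (fun r => (integral_comp_eval (μ := fun _ : Fin k => P) (i := r) hcen.1).trans hcen0)
    Finset.univ
  have heval (r : Fin k) : ∫ y : Fin k → E, ‖y r - a‖ ^ 2 ∂(Measure.pi fun _ => P) =
      ∫ x, ‖x - a‖ ^ 2 ∂P :=
    integral_comp_eval (μ := fun _ : Fin k => P) (i := r) (f := fun x => ‖x - a‖ ^ 2)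
      (by fun_prop)
  simp_rw [hsplit, norm_smul, mul_pow]
  rw [integral_const_mul, hsum]
  simp_rw [heval]
  rw [Finset.sum_const, Finset.card_univ, Fintype.card_fin, nsmul_eq_mul,
    Real.norm_of_nonneg (by positivity)]
  field_simp

theorem integral_norm_sub_sq_noisyMeanLaw {k : ℕ} (hk : k ≠ 0) (hP : MemLp id 2 P)
    (hN : MemLp id 2 N) (hN0 : ∫ z, z ∂N = 0) :
    ∫ y, ‖y - ∫ x, x ∂P‖ ^ 2 ∂noisyMeanLaw P N k =
      (k : ℝ)⁻¹ * ∫ x, ‖x - ∫ x', x' ∂P‖ ^ 2 ∂P + ∫ z, ‖z‖ ^ 2 ∂N := by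
  set a := ∫ x, x ∂P
  have hmean : MemLp (fun y : Fin k → E => (k : ℝ)⁻¹ • ∑ r, y r - a) 2 (Measure.pi fun _ => P) :=
    (memLp_mean P hP).sub (memLp_const a)
  have hfst := integral_fun_fst (μ := Measure.pi fun _ : Fin k => P) (ν := N)
    fun y => ‖(k : ℝ)⁻¹ • ∑ r, y r - a‖ ^ 2
  have hsnd := integral_fun_snd (μ := Measure.pi fun _ : Fin k => P) (ν := N)
    fun z => ‖z‖ ^ 2
  have hsnd0 := integral_fun_snd (μ := Measure.pi fun _ : Fin k => P) (ν := N) fun z => z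
  simp only [probReal_univ, one_smul] at hfst hsnd hsnd0
  rw [noisyMeanLaw, integral_map (by fun_prop) (by fun_prop)]
  simp_rw [add_sub_right_comm]
  have hindep := indepFun_prod (μ := Measure.pi fun _ : Fin k => P) (ν := N)
    (X := fun y : Fin k → E => (k : ℝ)⁻¹ • ∑ r, y r - a) (Y := fun z => z) (by fun_prop)
    measurable_id
  rw [integral_norm_add_sq_of_indepFun (Y := fun q => q.2) (hmean.comp_fst N) (hN.comp_snd _) hindep
    (hsnd0.trans hN0), hfst, hsnd, integral_norm_mean_sub_sq P hk hP]

end NoisyMean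

section Blocks

theorem pi_map_comp_of_injective {ι κ X : Type*} [Fintype ι] [Fintype κ] [MeasurableSpace X]
    (P : Measure X) [IsProbabilityMeasure P] {g : κ → ι} (hg : Function.Injective g) :
    (Measure.pi fun _ : ι => P).map (fun x j => x (g j)) = Measure.pi fun _ : κ => P := by
  simpa only [Measure.infinitePi_eq_pi] using
    Measure.map_infinitePi_infinitePi_of_inj (P := fun _ : ι => P) hg

theorem pi_map_curry {ι κ X : Type*} [Fintype ι] [Fintype κ] [MeasurableSpace X]
    (P : Measure X) [IsProbabilityMeasure P] :
    (Measure.pi fun _ : ι × κ => P).map (MeasurableEquiv.curry ι κ X) =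
      Measure.pi fun _ : ι => Measure.pi fun _ : κ => P := by
  simpa only [Measure.infinitePi_eq_pi] using
    Measure.infinitePi_map_curry (fun (_ : ι) (_ : κ) => P)

theorem pi_prod_pi_map {ι X Y Z : Type*} [Fintype ι] [MeasurableSpace X] [MeasurableSpace Y]
    [MeasurableSpace Z] (P : Measure X) (Q : Measure Y) [IsProbabilityMeasure P]
    [IsProbabilityMeasure Q] {f : X × Y → Z} (hf : Measurable f) :
    ((Measure.pi fun _ : ι => P).prod (Measure.pi fun _ : ι => Q)).map
        (fun q i => f (q.1 i, q.2 i)) =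
      Measure.pi fun _ : ι => (P.prod Q).map f := by
  have : IsProbabilityMeasure ((P.prod Q).map f) :=
    Measure.isProbabilityMeasure_map hf.aemeasurable
  rw [← Measure.pi_map_pi (f := fun _ : ι => f) fun _ => hf.aemeasurable,
    ← (measurePreserving_arrowProdEquivProdArrow X Y ι (fun _ => P) fun _ => Q).map_eq,
    Measure.map_map (by fun_prop) (by fun_prop)]
  rfl

variable {n d m k : ℕ}

theorem blockMean_eq (h : m * k ≤ n) (x : Fin n → EuclideanSpace ℝ (Fin d)) (p : Fin m) :
    blockMean k x p = (k : ℝ)⁻¹ • ∑ r : Fin k, x (Fin.castLE h (finProdFinEquiv (p, r))) := by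
  rw [blockMean]
  congr 1
  refine (Finset.sum_bij (fun r _ => Fin.castLE h (finProdFinEquiv (p, r))) (fun r _ => ?_)
    (fun r _ r' _ hr => by simpa using hr) (fun i hi => ?_) fun _ _ => rfl).symm
  · simp only [Finset.mem_filter_univ, Fin.val_castLE, finProdFinEquiv_apply_val]
    constructor <;> nlinarith [r.2]
  · obtain ⟨hle, hlt⟩ := Finset.mem_filter_univ _ |>.1 hi
    rw [add_one_mul] at hlt
    refine ⟨⟨i - p * k, by omega⟩, Finset.mem_univ _, Fin.ext ?_⟩
    simp only [Fin.val_castLE, finProdFinEquiv_apply_val]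
    rw [mul_comm k]
    omega

theorem pi_map_blocks {E : Type*} [MeasurableSpace E] (h : m * k ≤ n) (P : Measure E)
    [IsProbabilityMeasure P] :
    (Measure.pi fun _ : Fin n => P).map
        (fun x (p : Fin m) (r : Fin k) => x (Fin.castLE h (finProdFinEquiv (p, r)))) =
      Measure.pi fun _ : Fin m => Measure.pi fun _ : Fin k => P := by
  have hinj : Function.Injective fun q : Fin m × Fin k => Fin.castLE h (finProdFinEquiv q) :=
    (Fin.castLE_injective h).comp finProdFinEquiv.injective
  rw [← pi_map_curry, ← pi_map_comp_of_injective P hinj,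
    Measure.map_map (MeasurableEquiv.measurable _) (by fun_prop)]
  rfl

theorem measurable_blockMean_add :
    Measurable fun q : (Fin n → EuclideanSpace ℝ (Fin d)) × (Fin m → EuclideanSpace ℝ (Fin d)) =>
      fun p : Fin m => blockMean k q.1 p + q.2 p :=
  measurable_pi_lambda _ fun p => ((measurable_blockMean k p).comp measurable_fst).add
    ((measurable_pi_apply p).comp measurable_snd)

theorem map_blockMean_add_noiseLaw (h : m * k ≤ n) (P : Measure (EuclideanSpace ℝ (Fin d)))
    [IsProbabilityMeasure P] (s : ℝ) :
    ((Measure.pi fun _ : Fin n => P).prod (noiseLaw m d s)).map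
        (fun q (p : Fin m) => blockMean k q.1 p + q.2 p) =
      Measure.pi fun _ : Fin m =>
        noisyMeanLaw P (multivariateGaussian 0 (s • (1 : Matrix (Fin d) (Fin d) ℝ))) k := by
  unfold noisyMeanLaw
  have hprod := Measure.map_prod_map (Measure.pi fun _ : Fin n => P) (noiseLaw m d s)
    (f := fun x (p : Fin m) (r : Fin k) => x (Fin.castLE h (finProdFinEquiv (p, r))))
    (by fun_prop) measurable_id
  rw [pi_map_blocks h P, Measure.map_id, noiseLaw] at hprod
  rw [← pi_prod_pi_map _ _ (by fun_prop), hprod, Measure.map_map (by fun_prop) (by fun_prop)]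
  refine congrArg (Measure.map · _) (funext₂ fun q p => ?_)
  rw [blockMean_eq h]
  rfl

theorem meanEstimator_comp (c ε β : ℝ) (G : MedianSelector (numBlocks β) d)
    (μ : Measure (Fin n → EuclideanSpace ℝ (Fin d))) [SFinite μ] :
    meanEstimator c ε β G ∘ₘ μ =
      (μ.prod (noiseLaw (numBlocks β) d (noiseVariance d (n / numBlocks β) c ε))).map
        fun q => G.toFun fun p => blockMean (n / numBlocks β) q.1 p + q.2 p := by
  rw [meanEstimator, ← Measure.map_comp _ _ (measurable_noisyMedian _ G),
    ← Measure.compProd_eq_comp_prod, Measure.compProd_const]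

theorem meanEstimator_comp_pi (c ε β : ℝ) (G : MedianSelector (numBlocks β) d)
    (P : Measure (EuclideanSpace ℝ (Fin d))) [IsProbabilityMeasure P] :
    meanEstimator c ε β G ∘ₘ (Measure.pi fun _ : Fin n => P) =
      (Measure.pi fun _ => noisyMeanLaw P (multivariateGaussian 0
        (noiseVariance d (n / numBlocks β) c ε • (1 : Matrix (Fin d) (Fin d) ℝ)))
          (n / numBlocks β)).map G.toFun := by
  rw [meanEstimator_comp, ← map_blockMean_add_noiseLaw (Nat.mul_div_le n (numBlocks β)),
    Measure.map_map G.measurable measurable_blockMean_add]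
  rfl

end Blocks

section Accuracy

theorem numBlocks_pos {β : ℝ} (h0 : 0 < β) (h1 : β < 1) : 0 < numBlocks β := by
  have : 0 < Real.log (1 / β) := Real.log_pos ((one_lt_div h0).2 h1)
  exact Nat.ceil_pos.2 (by positivity)

theorem numBlocks_le_mul_max (β : ℝ) : (numBlocks β : ℝ) ≤ 201 * max 1 (Real.log (1 / β)) := by
  calc (numBlocks β : ℝ) ≤ (⌈200 * max 1 (Real.log (1 / β))⌉₊ : ℝ) := by
        unfold numBlocks
        gcongr
        exact le_max_right _ _
    _ ≤ 200 * max 1 (Real.log (1 / β)) + 1 := (Nat.ceil_lt_add_one (by positivity)).le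
    _ ≤ 201 * max 1 (Real.log (1 / β)) := by linarith [le_max_left 1 (Real.log (1 / β))]

theorem exp_neg_numBlocks_le {β : ℝ} (h0 : 0 < β) (h1 : β < 1) :
    Real.exp (-numBlocks β) ≤ β := by
  have hlog : 0 < Real.log (1 / β) := Real.log_pos ((one_lt_div h0).2 h1)
  have hceil : 200 * Real.log (1 / β) ≤ numBlocks β := Nat.le_ceil _
  calc Real.exp (-numBlocks β) ≤ Real.exp (-Real.log (1 / β)) := by
        gcongr
        linarith
    _ = β := by rw [one_div, Real.log_inv, neg_neg, Real.exp_log h0]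

theorem le_div_numBlocks {n : ℕ} {β K D : ℝ} (hm : 0 < numBlocks β) (hn : numBlocks β ≤ n)
    (hKD : 402 * K * (max 1 (Real.log (1 / β)) * D) ≤ n) :
    K * D ≤ (n / numBlocks β : ℕ) := by
  set M := max 1 (Real.log (1 / β))
  have hM : 0 < M := one_pos.trans_le (le_max_left _ _)
  have hdiv : n ≤ 2 * numBlocks β * (n / numBlocks β) := by
    nlinarith [Nat.lt_mul_div_succ n hm, (Nat.one_le_div_iff hm).2 hn]
  refine le_of_mul_le_mul_left ?_ (show 0 < 402 * M by positivity)
  calc 402 * M * (K * D) = 402 * K * (M * D) := by ring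
    _ ≤ n := hKD
    _ ≤ 2 * numBlocks β * (n / numBlocks β : ℕ) := by exact_mod_cast hdiv
    _ ≤ 2 * (201 * M) * (n / numBlocks β : ℕ) := by
        gcongr
        exact numBlocks_le_mul_max β
    _ = 402 * M * (n / numBlocks β : ℕ) := by ring

theorem noiseVariance_nonneg (d k : ℕ) {c ε : ℝ} (hc : 0 ≤ c) (hε : 0 ≤ ε) :
    0 ≤ noiseVariance d k c ε := by
  unfold noiseVariance
  positivity

theorem integral_norm_sq_multivariateGaussian_smul_one (d : ℕ) {s : ℝ} (hs : 0 ≤ s) :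
    ∫ z, ‖z‖ ^ 2 ∂multivariateGaussian 0 (s • (1 : Matrix (Fin d) (Fin d) ℝ)) = d * s := by
  rw [multivariateGaussian_smul_one d hs, integral_map (by fun_prop) (by fun_prop)]
  simp_rw [norm_smul, mul_pow, Real.norm_eq_abs, sq_abs, Real.sq_sqrt hs]
  rw [integral_const_mul, integral_norm_sq_stdGaussian, finrank_euclideanSpace_fin, mul_comm]

/- Each of the two terms of the error contributes `α ^ 2 / 2`: the sampling error by the first
summand of the sample size bound, the noise by the square of the second. -/
theorem mul_inv_mul_add_noiseVariance_le {d k : ℕ} {c α ε T : ℝ} (hd : 1 ≤ d) (hc : 0 ≤ c)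
    (hα : 0 < α) (hε : 0 < ε) (hT : 0 ≤ T)
    (hk : (1 + 2 * T * c) * (d / α ^ 2 + d / (α * √ε)) ≤ k) :
    T * ((k : ℝ)⁻¹ * c + d * noiseVariance d k c ε) ≤ α ^ 2 := by
  have hd' : (1 : ℝ) ≤ d := by exact_mod_cast hd
  have hk0 : (0 : ℝ) < k := lt_of_lt_of_le (by positivity) hk
  have hsample : (1 + 2 * T * c) * d ≤ k * α ^ 2 := by
    rw [← div_le_iff₀ (by positivity), mul_div_assoc]
    exact le_trans (by gcongr; exact le_add_of_nonneg_right (by positivity)) hk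
  have hnoise : (1 + 2 * T * c) * d ≤ k * (α * √ε) := by
    rw [← div_le_iff₀ (by positivity), mul_div_assoc]
    exact le_trans (by gcongr; exact le_add_of_nonneg_left (by positivity)) hk
  have hTc : 0 ≤ T * c := by positivity
  have hsample' : T * ((k : ℝ)⁻¹ * c) ≤ α ^ 2 / 2 := by
    rw [inv_mul_eq_div, ← mul_div_assoc, div_le_iff₀ hk0]
    nlinarith
  have hnoise' : T * (d * noiseVariance d k c ε) ≤ α ^ 2 / 2 := by
    have hsq : ((1 + 2 * T * c) * d) ^ 2 ≤ k ^ 2 * α ^ 2 * ε := by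
      calc _ ≤ (k * (α * √ε)) ^ 2 := by gcongr
        _ = k ^ 2 * α ^ 2 * ε := by rw [mul_pow, mul_pow, Real.sq_sqrt hε.le, mul_assoc]
    have hTc_le : T * c * d ^ 2 ≤ k ^ 2 * α ^ 2 * ε := by
      refine le_trans ?_ hsq
      rw [mul_pow]
      gcongr
      nlinarith
    calc T * (d * noiseVariance d k c ε) = T * c * d ^ 2 / (2 * k ^ 2 * ε) := by
          rw [noiseVariance]
          ring
      _ ≤ k ^ 2 * α ^ 2 * ε / (2 * k ^ 2 * ε) := by gcongr
      _ = α ^ 2 / 2 := by field_simp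
  linarith

theorem le_real_meanEstimator_comp_pi {c α β ε : ℝ} {d n : ℕ} (hc : 0 < c) (hd : 1 ≤ d)
    (hα : 0 < α) (hβ : 0 < β) (hβ1 : β < 1) (hε : 0 < ε) (hn : numBlocks β ≤ n)
    (G : MedianSelector (numBlocks β) d)
    (hC : 402 * (1 + 2 * (16 * Real.exp 6) * c) *
      (max 1 (Real.log (1 / β)) * (d / α ^ 2 + d / (α * √ε))) ≤ n)
    (P : Measure (EuclideanSpace ℝ (Fin d))) [IsProbabilityMeasure P] (hP : MemLp id 2 P)
    (hPc : ∫ x, ‖x - ∫ x', x' ∂P‖ ^ 2 ∂P ≤ c) :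
    1 - β ≤ (meanEstimator (n := n) c ε β G ∘ₘ (Measure.pi fun _ => P)).real
      {y | ‖y - ∫ x, x ∂P‖ ≤ α} := by
  set a := ∫ x, x ∂P
  set k := n / numBlocks β
  set s := noiseVariance d k c ε
  set N := multivariateGaussian 0 (s • (1 : Matrix (Fin d) (Fin d) ℝ)) with hN
  have hm : 0 < numBlocks β := numBlocks_pos hβ hβ1
  have hk : k ≠ 0 := (Nat.div_pos hn hm).ne'
  have hQ : MemLp (fun x => x - a) 2 (noisyMeanLaw P N k) :=
    (memLp_noisyMeanLaw P N k hP IsGaussian.memLp_two_id).sub (memLp_const a)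
  have hmse : ∫ x, ‖x - a‖ ^ 2 ∂noisyMeanLaw P N k ≤ (k : ℝ)⁻¹ * c + d * s := by
    rw [integral_norm_sub_sq_noisyMeanLaw P N hk hP IsGaussian.memLp_two_id (by simp [hN]),
      integral_norm_sq_multivariateGaussian_smul_one d (noiseVariance_nonneg d k hc.le hε.le)]
    gcongr
  have hfar : (noisyMeanLaw P N k).real {x | α / 4 < ‖x - a‖} ≤ Real.exp (-6) := by
    refine (measureReal_lt_norm_le _ hQ (by positivity)).trans ?_
    have hK := mul_inv_mul_add_noiseVariance_le hd hc.le hα hε (by positivity)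
      (le_div_numBlocks hm hn hC)
    rw [Real.exp_neg, div_le_iff₀ (by positivity), inv_mul_eq_div, le_div_iff₀ (by positivity)]
    nlinarith [Real.exp_pos 6]
  have hmedian := measureReal_pi_lt_norm_sub_le (noisyMeanLaw P N k)
    (fun v => G.isGeometricMedian v a) hfar
  have hclosed : MeasurableSet {y : EuclideanSpace ℝ (Fin d) | ‖y - a‖ ≤ α} :=
    measurableSet_le (by fun_prop) (by fun_prop)
  rw [meanEstimator_comp_pi, map_measureReal_apply G.measurable hclosed,
    ← compl_compl (G.toFun ⁻¹' _), probReal_compl_eq_one_sub (G.measurable hclosed).compl]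
  refine sub_le_sub_left (le_trans ?_ (exp_neg_numBlocks_le hβ hβ1)) 1
  simpa [Set.preimage, Set.compl_ofPred, mul_div_cancel₀] using hmedian

end Accuracy

end MIPrivacy

theorem mainTheorem10 (c : ℝ) (hc : 0 < c) :
    ∃ C : ℝ, 0 < C ∧
      ∀ (d n : ℕ) (α β ε : ℝ), 1 ≤ d → 0 < α → 0 < β → β < 1 → 0 < ε →
        MIPrivacy.numBlocks β ≤ n →
        ∀ G : MIPrivacy.MedianSelector (MIPrivacy.numBlocks β) d,
          MIPrivacy.IsMIDP (MIPrivacy.meanEstimator (n := n) c ε β G) ε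
              (MIPrivacy.secondMomentClass n d c) ∧
          (C * (max 1 (Real.log (1 / β)) * (d / α ^ 2 + d / (α * Real.sqrt ε))) ≤ n →
            ∀ (P : Measure (EuclideanSpace ℝ (Fin d))) [IsProbabilityMeasure P],
              MemLp id 2 P → ∫ x, ‖x - ∫ x', x' ∂P‖ ^ 2 ∂P ≤ c →
              1 - β ≤
                ((MIPrivacy.meanEstimator (n := n) c ε β G) ∘ₘ (Measure.pi fun _ => P)).real
                  {y | ‖y - ∫ x, x ∂P‖ ≤ α}) := by
  refine ⟨402 * (1 + 2 * (16 * Real.exp 6) * c), by positivity,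
    fun d n α β ε hd hα hβ hβ1 hε hn G => ⟨?_, fun hC P _ hP hPc => ?_⟩⟩
  · exact MIPrivacy.isMIDP_meanEstimator hd hc hε
      (Nat.div_pos hn (MIPrivacy.numBlocks_pos hβ hβ1)) G
  · exact MIPrivacy.le_real_meanEstimator_comp_pi hc hd hα hβ hβ1 hε hn G hC P hP hPc
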